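/- All Banach spaces are real. For a Banach space $X$, let $\operatorname{dens} X$ denote its density character, i.e. the least cardinality of a dense subset of $X$. A subset $S\subseteq X$ is called overcomplete if $|S|=\operatorname{dens} X$ and every subset $\Lambda\subseteq S$ with $|\Lambda|=|S|$ is linearly dense in $X$ (i.e. $\overline{\operatorname{span}}\,\Lambda = X$). Theorem. For every uncountable set $\Gamma$, the Banach space $\ell_1(\Gamma)$ contains no overcomplete set. -/

import Mathlib

open Cardinal
open scoped lp

universe u

/-- The density character `dens X` of a topological space: the least cardinality of a dense
subset. -/
noncomputable def densityCharacter (X : Type u) [TopologicalSpace X] : Cardinal.{u} :=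
  sInf {κ : Cardinal.{u} | ∃ D : Set X, Dense D ∧ #D = κ}

/-- A subset `S` of a (real) Banach space `X` is overcomplete if `|S| = dens X` and every subset
of `S` having the same cardinality as `S` is linearly dense in `X`, that is, its linear span is
dense. -/
def IsOvercomplete {X : Type u} [NormedAddCommGroup X] [NormedSpace ℝ X] (S : Set X) : Prop :=
  #S = densityCharacter X ∧
    ∀ Λ : Set X, Λ ⊆ S → #Λ = #S → Dense (Submodule.span ℝ Λ : Set X)

/-!
Let `S` be an overcomplete subset of `ℓ¹(Γ)`, where `Γ` is uncountable, and let `κ = |S|`. Since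
`κ` is the density character of `ℓ¹(Γ)`, it is at most `|Γ|` (`densityCharacter_lp_le`). The
theorem is proved by exhibiting `κ` elements of `S` whose closed span is not the whole space. There
are two cases.

*The case `κ > ℵ₁`.* Some coordinate vanishes at `κ` elements of `S`, so these lie in a closed
hyperplane. Otherwise the set `Z γ` of the elements of `S` vanishing at `γ` has fewer than `κ`
elements for each `γ`. As `|Γ| > ℵ₁`, there are `ℵ₁` coordinates `γ` for which `|Z γ|` is bounded by
one cardinal `c < κ` (`exists_uncountable_setOf_le`). The union of these `Z γ` has at most
`ℵ₁ * c < κ` elements, so some element of `S` has `ℵ₁` nonzero coordinates, which is impossible for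
a summable family.

*The case `κ ≤ ℵ₁`.* Here an uncountable subset is enough. Call a set of vectors concentrated if,
for a fixed `η > 0`, there is a countable set of coordinates outside which each of the vectors has
`ℓ¹`-mass at most `η`. Concentrated sets form a `σ`-ideal, and a linearly dense set is not
concentrated once `η` is small (`exists_not_isConcentrated`). Give each `x ∈ S` a finite set `F x`
of coordinates outside which `x` has mass at most `η / 4`. A `Δ`-system argument relative to the
`σ`-ideal (`exists_pairwiseDisjoint_blocks`) yields an uncountable bounded subset `D` of `S` and
pairwise disjoint finite blocks `G x`, `x ∈ D`, such that `x` has mass at least `3η / 4` on `G x` and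
at most `η / 4` on the union of the other blocks. Such a family is equivalent to the unit
vector basis of `ℓ¹(D)`, and the unit vector at a coordinate `γ` outside all the blocks has positive
distance to its span (`not_dense_span_of_blocks`). A coordinate `γ` outside the blocks is made
available by removing one vector from `D`.
-/

/-! ### Coordinates and partial sums of norms in `ℓ¹` -/

theorem abs_apply_le_norm {Γ : Type u} (x : ℓ¹(Γ, ℝ)) (i : Γ) : |x i| ≤ ‖x‖ := by
  simpa using lp.norm_apply_le_norm one_ne_zero x i

theorem sum_abs_le_norm {Γ : Type u} (x : ℓ¹(Γ, ℝ)) (A : Finset Γ) : ∑ i ∈ A, |x i| ≤ ‖x‖ := by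
  simpa using lp.sum_rpow_le_norm_rpow (p := 1) (by simp) x A

theorem summable_abs_apply {Γ : Type u} (x : ℓ¹(Γ, ℝ)) : Summable fun i => |x i| := by
  simpa using (lp.memℓp x).summable (by simp)

theorem countable_setOf_apply_ne_zero {Γ : Type u} (x : ℓ¹(Γ, ℝ)) : {i | x i ≠ 0}.Countable := by
  simpa [Function.support] using (summable_abs_apply x).countable_support

/-- The `ℓ¹`-mass of a vector outside a suitable finite set is as small as desired. -/
theorem exists_finset_sum_abs_le {Γ : Type u} (x : ℓ¹(Γ, ℝ)) {ε : ℝ} (hε : 0 < ε) :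
    ∃ F : Finset Γ, ∀ A : Finset Γ, Disjoint A F → ∑ i ∈ A, |x i| ≤ ε := by
  obtain ⟨F, hF⟩ := summable_iff_vanishing_norm.1 (summable_abs_apply x) ε hε
  exact ⟨F, fun A hA => (le_abs_self _).trans (hF A hA).le⟩

/-! ### The density character of `ℓ¹` -/

/-- The finitely supported rational vectors are dense in `ℓ¹(Γ)`. -/
theorem densityCharacter_lp_le (Γ : Type u) [Infinite Γ] :
    densityCharacter ℓ¹(Γ, ℝ) ≤ #Γ := by
  classical
  let φ : (Γ →₀ ℚ) →+ ℓ¹(Γ, ℝ) := Finsupp.liftAddHom fun γ =>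
    (lp.singleAddMonoidHom (E := fun _ : Γ => ℝ) 1 γ).comp (Rat.castHom ℝ).toAddMonoidHom
  have hφ : ∀ γ q, φ (Finsupp.single γ q) = lp.single 1 γ (q : ℝ) := fun γ q => by
    simp [φ, lp.singleAddMonoidHom]
  have hsingle : ∀ γ (c : ℝ), lp.single 1 γ c ∈ φ.range.topologicalClosure := by
    intro γ c
    have hc : c ∈ closure (Set.range ((↑) : ℚ → ℝ)) := Rat.denseRange_cast c
    have h := image_closure_subset_closure_image
      (lp.isometry_single (E := fun _ : Γ => ℝ) (p := 1) γ).continuous (Set.mem_image_of_mem _ hc)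
    refine closure_mono ?_ h
    rintro _ ⟨_, ⟨q, rfl⟩, rfl⟩
    exact ⟨_, hφ γ q⟩
  have hdense : Dense (Set.range φ) := by
    intro x
    exact φ.range.isClosed_topologicalClosure.mem_of_tendsto
      (lp.hasSum_single (by simp) x) (.of_forall fun s => sum_mem fun i _ => hsingle i (x i))
  calc densityCharacter ℓ¹(Γ, ℝ) ≤ #(Set.range φ) := csInf_le' ⟨_, hdense, rfl⟩
    _ ≤ #(Γ →₀ ℚ) := mk_range_le
    _ = #Γ := by simp

/-! ### Families with non-dense span -/

theorem not_dense_span_of_apply_eq_zero {Γ : Type u} {Λ : Set ℓ¹(Γ, ℝ)} {γ : Γ}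
    (h : ∀ x ∈ Λ, x γ = 0) : ¬ Dense (Submodule.span ℝ Λ : Set ℓ¹(Γ, ℝ)) := by
  classical
  intro hd
  have hs : ∀ v ∈ Submodule.span ℝ Λ, v γ = 0 := by
    intro v hv
    induction hv using Submodule.span_induction with
    | mem x hx => exact h x hx
    | zero => simp
    | add x y _ _ hx hy => simp [hx, hy]
    | smul a x _ hx => simp [hx]
  obtain ⟨v, hv, hlt⟩ := hd.exists_dist_lt (lp.single 1 γ (1 : ℝ)) one_pos
  have h1 := abs_apply_le_norm (lp.single 1 γ (1 : ℝ) - v) γ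
  rw [dist_eq_norm] at hlt
  simp [hs v hv] at h1
  linarith

/-- A combination of vectors which are large on their own blocks and small on the other blocks
has norm on the union of the blocks at least a multiple of the `ℓ¹`-norm of the coefficients. -/
theorem mul_sum_abs_le_of_blocks {Γ ι : Type*} [DecidableEq Γ] (t : Finset ι) (x : ι → Γ → ℝ)
    (G : ι → Finset Γ) (a : ι → ℝ) (hdisj : (t : Set ι).PairwiseDisjoint G) {p q : ℝ}
    (hbig : ∀ k ∈ t, p ≤ ∑ i ∈ G k, |x k i|)
    (hsmall : ∀ k ∈ t, ∀ A : Finset Γ, (∀ i ∈ A, ∃ l ∈ t, l ≠ k ∧ i ∈ G l) →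
      ∑ i ∈ A, |x k i| ≤ q) :
    (p - q) * ∑ k ∈ t, |a k| ≤ ∑ i ∈ t.biUnion G, |∑ k ∈ t, a k * x k i| := by
  classical
  have hpt : ∀ l ∈ t, ∀ i, |a l| * |x l i| - ∑ k ∈ t.erase l, |a k| * |x k i| ≤
      |∑ k ∈ t, a k * x k i| := by
    intro l hl i
    rw [← Finset.add_sum_erase t _ hl]
    have h1 : |∑ k ∈ t.erase l, a k * x k i| ≤ ∑ k ∈ t.erase l, |a k| * |x k i| :=
      (Finset.abs_sum_le_sum_abs _ _).trans_eq (by simp [abs_mul])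
    have h2 := abs_sub_abs_le_abs_add (a l * x l i) (∑ k ∈ t.erase l, a k * x k i)
    rw [abs_mul] at h2
    linarith
  have hcross : ∀ k ∈ t, ∑ l ∈ t.erase k, ∑ i ∈ G l, |x k i| ≤ q := by
    intro k hk
    rw [← Finset.sum_biUnion (hdisj.subset (by simp))]
    refine hsmall k hk _ fun i hi => ?_
    obtain ⟨l, hl, hil⟩ := Finset.mem_biUnion.1 hi
    exact ⟨l, Finset.mem_of_mem_erase hl, Finset.ne_of_mem_erase hl, hil⟩
  have hswap : ∑ l ∈ t, ∑ i ∈ G l, ∑ k ∈ t.erase l, |a k| * |x k i| =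
      ∑ k ∈ t, |a k| * ∑ l ∈ t.erase k, ∑ i ∈ G l, |x k i| := by
    simp_rw [Finset.mul_sum]
    rw [Finset.sum_comm' (t' := t) (s' := fun k => t.erase k)
      (s := t) (t := fun l => t.erase l) (f := fun l k => ∑ i ∈ G l, |a k| * |x k i|)
      (by intro l k; simp only [Finset.mem_erase]; tauto) |>.symm]
    exact Finset.sum_congr rfl fun l _ => Finset.sum_comm
  calc (p - q) * ∑ k ∈ t, |a k|
      = ∑ k ∈ t, |a k| * p - ∑ k ∈ t, |a k| * q := by
        rw [← Finset.sum_mul, ← Finset.sum_mul]; ring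
    _ ≤ ∑ k ∈ t, |a k| * ∑ i ∈ G k, |x k i| -
          ∑ k ∈ t, |a k| * ∑ l ∈ t.erase k, ∑ i ∈ G l, |x k i| := by
        gcongr with k hk k hk
        · exact hbig k hk
        · exact hcross k hk
    _ = ∑ l ∈ t, ∑ i ∈ G l, (|a l| * |x l i| - ∑ k ∈ t.erase l, |a k| * |x k i|) := by
        rw [← hswap, ← Finset.sum_sub_distrib]
        simp [Finset.mul_sum, Finset.sum_sub_distrib]
    _ ≤ ∑ l ∈ t, ∑ i ∈ G l, |∑ k ∈ t, a k * x k i| :=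
        Finset.sum_le_sum fun l hl => Finset.sum_le_sum fun i _ => hpt l hl i
    _ = _ := (Finset.sum_biUnion hdisj).symm

/-- A bounded family of vectors, each large on its own block and small on the other blocks, does
not have dense span if some coordinate lies outside all the blocks. -/
theorem not_dense_span_of_blocks {Γ : Type u} {D : Set ℓ¹(Γ, ℝ)} (G : ℓ¹(Γ, ℝ) → Finset Γ)
    {p q M : ℝ} (hpq : q < p) (hM : ∀ x ∈ D, ‖x‖ ≤ M) (hdisj : D.PairwiseDisjoint G)
    (hbig : ∀ x ∈ D, p ≤ ∑ i ∈ G x, |x i|)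
    (hsmall : ∀ x ∈ D, ∀ A : Finset Γ, (∀ i ∈ A, ∃ y ∈ D, y ≠ x ∧ i ∈ G y) →
      ∑ i ∈ A, |x i| ≤ q)
    {γ : Γ} (hγ : ∀ x ∈ D, γ ∉ G x) :
    ¬ Dense (Submodule.span ℝ D : Set ℓ¹(Γ, ℝ)) := by
  classical
  intro hd
  have hpos : 0 < p - q := sub_pos.2 hpq
  have hden : 0 < p - q + |M| := by positivity
  -- The unit vector at `γ` is shown to have distance at least this number from the span.
  obtain ⟨v, hv, hlt⟩ := hd.exists_dist_lt (lp.single 1 γ (1 : ℝ)) (div_pos hpos hden)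
  rw [dist_eq_norm] at hlt
  obtain ⟨c, hc, rfl⟩ := Submodule.mem_span_set.1 hv
  have hcoord : ∀ i, (c.sum fun x r => r • x : ℓ¹(Γ, ℝ)) i = ∑ x ∈ c.support, c x * x i := by
    intro i
    rw [Finsupp.sum, lp.coeFn_sum, Finset.sum_apply]
    simp
  set w : ℓ¹(Γ, ℝ) := lp.single 1 γ (1 : ℝ) - c.sum fun x r => r • x with hw
  have h1 := mul_sum_abs_le_of_blocks c.support (fun x i => x i) G c (hdisj.subset hc)
    (fun x hx => hbig x (hc hx)) (q := q) (fun x hx A hA => hsmall x (hc hx) A fun i hi => by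
      obtain ⟨y, hy, h⟩ := hA i hi
      exact ⟨y, hc hy, h⟩)
  have h2 : ∑ i ∈ c.support.biUnion G, |∑ x ∈ c.support, c x * x i| ≤ ‖w‖ := by
    refine le_trans (le_of_eq (Finset.sum_congr rfl fun i hi => ?_))
      (sum_abs_le_norm w (c.support.biUnion G))
    obtain ⟨x, hx, hix⟩ := Finset.mem_biUnion.1 hi
    have hne : i ≠ γ := by
      rintro rfl
      exact hγ x (hc hx) hix
    simp [hw, ← hcoord, hne]
  have h3 : 1 - |M| * ∑ x ∈ c.support, |c x| ≤ ‖w‖ := by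
    have hb : |∑ x ∈ c.support, c x * x γ| ≤ |M| * ∑ x ∈ c.support, |c x| := by
      refine (Finset.abs_sum_le_sum_abs _ _).trans ?_
      rw [Finset.mul_sum]
      refine Finset.sum_le_sum fun x hx => ?_
      rw [abs_mul, mul_comm]
      exact mul_le_mul_of_nonneg_right
        ((abs_apply_le_norm x γ).trans ((hM x (hc hx)).trans (le_abs_self M))) (abs_nonneg _)
    have ha := abs_apply_le_norm w γ
    have he : w γ = 1 - ∑ x ∈ c.support, c x * x γ := by simp [hw, ← hcoord]
    rw [he] at ha
    linarith [le_abs_self (1 - ∑ x ∈ c.support, c x * x γ),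
      le_abs_self (∑ x ∈ c.support, c x * x γ)]
  rw [lt_div_iff₀ hden] at hlt
  nlinarith [mul_le_mul_of_nonneg_left (h1.trans h2) (abs_nonneg M),
    mul_le_mul_of_nonneg_left h3 hpos.le]

/-! ### The `σ`-ideal of concentrated sets -/

/-- A set `T` of vectors is `η`-concentrated if there is a countable set `C` of coordinates outside
which each vector of `T` has `ℓ¹`-mass at most `η`. The mass is expressed by means of the sums over
the finite sets of coordinates disjoint from `C`. -/
def IsConcentrated {Γ : Type u} (η : ℝ) (T : Set ℓ¹(Γ, ℝ)) : Prop :=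
  ∃ C : Set Γ, C.Countable ∧
    ∀ x ∈ T, ∀ A : Finset Γ, Disjoint (A : Set Γ) C → ∑ i ∈ A, |x i| ≤ η

theorem IsConcentrated.mono {Γ : Type u} {η : ℝ} {T T' : Set ℓ¹(Γ, ℝ)}
    (h : IsConcentrated η T') (hT : T ⊆ T') : IsConcentrated η T := by
  obtain ⟨C, hC, hx⟩ := h
  exact ⟨C, hC, fun x hxT => hx x (hT hxT)⟩

theorem IsConcentrated.biUnion {Γ : Type u} {η : ℝ} {ι : Type*} {I : Set ι} (hI : I.Countable)
    {T : ι → Set ℓ¹(Γ, ℝ)} (h : ∀ i ∈ I, IsConcentrated η (T i)) :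
    IsConcentrated η (⋃ i ∈ I, T i) := by
  choose! C hC hx using h
  refine ⟨⋃ i ∈ I, C i, hI.biUnion hC, fun x hxT A hA => ?_⟩
  obtain ⟨i, hi, hxi⟩ := Set.mem_iUnion₂.1 hxT
  exact hx i hi x hxi A (hA.mono_right (Set.subset_biUnion_of_mem hi))

theorem IsConcentrated.iUnion {Γ : Type u} {η : ℝ} {ι : Type*} [Countable ι]
    {T : ι → Set ℓ¹(Γ, ℝ)} (h : ∀ i, IsConcentrated η (T i)) : IsConcentrated η (⋃ i, T i) := by
  simpa using IsConcentrated.biUnion (Set.countable_univ (α := ι)) (T := T) fun i _ => h i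

theorem IsConcentrated.union {Γ : Type u} {η : ℝ} {T T' : Set ℓ¹(Γ, ℝ)}
    (h : IsConcentrated η T) (h' : IsConcentrated η T') : IsConcentrated η (T ∪ T') := by
  rw [Set.union_eq_iUnion]
  exact .iUnion (by rintro (_ | _) <;> assumption)

theorem exists_not_isConcentrated {Γ : Type u} [Uncountable Γ] {S : Set ℓ¹(Γ, ℝ)}
    (hS : Dense (Submodule.span ℝ S : Set ℓ¹(Γ, ℝ))) : ∃ η > 0, ¬ IsConcentrated η S := by
  by_contra! h
  choose C hC hx using fun n : ℕ => h (1 / ((n : ℝ) + 1)) Nat.one_div_pos_of_nat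
  obtain ⟨γ, hγ⟩ : ∃ γ, γ ∉ ⋃ n, C n := by
    by_contra! hall
    exact Set.not_countable_univ ((Set.countable_iUnion hC).mono fun γ _ => hall γ)
  rw [Set.mem_iUnion, not_exists] at hγ
  refine not_dense_span_of_apply_eq_zero (γ := γ) (fun x hxS => ?_) hS
  have hle : ∀ n : ℕ, |x γ| ≤ 1 / ((n : ℝ) + 1) := fun n => by
    simpa using hx n x hxS {γ} (by simpa using hγ n)
  exact abs_nonpos_iff.1 (ge_of_tendsto' tendsto_one_div_add_atTop_nhds_zero_nat hle)

/-! ### Extraction of disjoint blocks -/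

/-- The root `Δ` of the `Δ`-system: any coordinate outside `Δ` belongs to few of the sets `F x`
containing `Δ`. -/
theorem exists_root {Γ : Type u} {η : ℝ} {T : Set ℓ¹(Γ, ℝ)} (hT : ¬ IsConcentrated η T)
    (F : ℓ¹(Γ, ℝ) → Finset Γ) {n : ℕ} (hn : ∀ x ∈ T, (F x).card ≤ n) :
    ∃ Δ : Finset Γ, ¬ IsConcentrated η {x ∈ T | Δ ⊆ F x} ∧
      ∀ γ ∉ Δ, IsConcentrated η {x ∈ T | Δ ⊆ F x ∧ γ ∈ F x} := by
  classical
  by_contra! h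
  have hk : ∀ k : ℕ, ∃ Δ : Finset Γ, Δ.card = k ∧ ¬ IsConcentrated η {x ∈ T | Δ ⊆ F x} := by
    intro k
    induction k with
    | zero => exact ⟨∅, rfl, by simpa using hT⟩
    | succ k ih =>
      obtain ⟨Δ, hcard, hΔ⟩ := ih
      obtain ⟨γ, hγ, hγ'⟩ := h Δ hΔ
      refine ⟨insert γ Δ, by rw [Finset.card_insert_of_notMem hγ, hcard], fun hc => hγ' ?_⟩
      exact hc.mono fun x hx => ⟨hx.1, Finset.insert_subset hx.2.2 hx.2.1⟩
  obtain ⟨Δ, hcard, hΔ⟩ := hk (n + 1)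
  refine hΔ ⟨∅, Set.countable_empty, ?_⟩
  rintro x ⟨hx, hsub⟩
  have := Finset.card_le_card hsub
  have := hn x hx
  omega

/-- A set which is not concentrated contains an uncountable bounded family of vectors with
pairwise disjoint blocks as in `not_dense_span_of_blocks`. -/
theorem exists_pairwiseDisjoint_blocks {Γ : Type u} {η : ℝ} (hη : 0 < η) {S : Set ℓ¹(Γ, ℝ)}
    (hS : ¬ IsConcentrated η S) :
    ∃ D ⊆ S, ¬ D.Countable ∧ ∃ (G : ℓ¹(Γ, ℝ) → Finset Γ) (M : ℝ), (∀ x ∈ D, ‖x‖ ≤ M) ∧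
      D.PairwiseDisjoint G ∧ (∀ x ∈ D, η - η / 4 ≤ ∑ i ∈ G x, |x i|) ∧
      ∀ x ∈ D, ∀ A : Finset Γ, (∀ i ∈ A, ∃ y ∈ D, y ≠ x ∧ i ∈ G y) →
        ∑ i ∈ A, |x i| ≤ η / 4 := by
  classical
  choose F hF using fun x : ℓ¹(Γ, ℝ) => exists_finset_sum_abs_le x (ε := η / 4) (by positivity)
  obtain ⟨n, hn⟩ : ∃ n : ℕ, ¬ IsConcentrated η {x ∈ S | ‖x‖ ≤ n ∧ (F x).card ≤ n} := by
    by_contra! h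
    refine hS ((IsConcentrated.iUnion h).mono fun x hx => ?_)
    obtain ⟨m, hm⟩ := exists_nat_ge ‖x‖
    refine Set.mem_iUnion.2 ⟨max m (F x).card, hx, hm.trans ?_, le_max_right _ _⟩
    exact_mod_cast le_max_left _ _
  set T := {x ∈ S | ‖x‖ ≤ n ∧ (F x).card ≤ n}
  obtain ⟨Δ, hΔ, hfew⟩ := exists_root hn F (n := n) fun x hx => hx.2.2
  let G : ℓ¹(Γ, ℝ) → Finset Γ := fun x => F x \ Δ
  -- Vectors concentrated on the root are discarded.
  let T' : Set ℓ¹(Γ, ℝ) :=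
    {x | (x ∈ T ∧ Δ ⊆ F x) ∧ ∃ A : Finset Γ, Disjoint A Δ ∧ η < ∑ i ∈ A, |x i|}
  have hT' : ¬ IsConcentrated η T' := by
    intro h
    have h0 : IsConcentrated η {x | (x ∈ T ∧ Δ ⊆ F x) ∧
        ∀ A : Finset Γ, Disjoint A Δ → ∑ i ∈ A, |x i| ≤ η} :=
      ⟨Δ, Δ.countable_toSet, fun x hx A hA => hx.2 A (by exact_mod_cast hA)⟩
    refine hΔ ((h.union h0).mono fun x hx => ?_)
    by_cases hA : ∃ A : Finset Γ, Disjoint A Δ ∧ η < ∑ i ∈ A, |x i|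
    · exact Or.inl ⟨hx, hA⟩
    · push Not at hA
      exact Or.inr ⟨hx, hA⟩
  have hbig : ∀ x ∈ T', η - η / 4 ≤ ∑ i ∈ G x, |x i| := by
    rintro x ⟨-, A, hA, hlt⟩
    have h1 := Finset.sum_inter_add_sum_sdiff A (F x) fun i => |x i|
    have h2 := hF x (A \ F x) Finset.sdiff_disjoint
    have h3 : ∑ i ∈ A ∩ F x, |x i| ≤ ∑ i ∈ G x, |x i| := by
      refine Finset.sum_le_sum_of_subset_of_nonneg (fun i hi => ?_) fun _ _ _ => abs_nonneg _
      rw [Finset.mem_inter] at hi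
      exact Finset.mem_sdiff.2 ⟨hi.2, Finset.disjoint_left.1 hA hi.1⟩
    linarith
  -- A maximal subfamily of `T'` with pairwise disjoint blocks is uncountable.
  obtain ⟨D, hD⟩ := zorn_subset {D : Set ℓ¹(Γ, ℝ) | D ⊆ T' ∧ D.PairwiseDisjoint G} <| by
    intro c hc hchain
    refine ⟨⋃₀ c, ⟨Set.sUnion_subset fun D hD => (hc hD).1, ?_⟩,
      fun D hD => Set.subset_sUnion_of_mem hD⟩
    exact (Set.pairwiseDisjoint_sUnion hchain.directedOn).2 fun D hD => (hc hD).2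
  have hDT : D ⊆ T' := hD.prop.1
  have hdisj : D.PairwiseDisjoint G := hD.prop.2
  refine ⟨D, fun x hx => (hDT hx).1.1.1, fun hcount => hT' ?_, G, n,
    fun x hx => (hDT hx).1.1.2.1, hdisj, fun x hx => hbig x (hDT hx), ?_⟩
  · have hU : (⋃ x ∈ D, (G x : Set Γ)).Countable :=
      hcount.biUnion fun x _ => (G x).countable_toSet
    refine (IsConcentrated.biUnion hU (T := fun γ => {x | x ∈ T ∧ Δ ⊆ F x ∧ γ ∈ F x})
      fun γ hγ => ?_).mono fun x hx => ?_
    · obtain ⟨x, -, hx⟩ := Set.mem_iUnion₂.1 hγ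
      exact hfew γ (Finset.mem_sdiff.1 hx).2
    · obtain ⟨γ, hγ, hγx⟩ : ∃ γ ∈ ⋃ x ∈ D, (G x : Set Γ), γ ∈ G x := by
        by_cases hxD : x ∈ D
        · obtain ⟨γ, hγ⟩ : (G x).Nonempty := by
            rw [Finset.nonempty_iff_ne_empty]
            intro he
            have := hbig x hx
            rw [he, Finset.sum_empty] at this
            linarith
          exact ⟨γ, Set.mem_iUnion₂.2 ⟨x, hxD, hγ⟩, hγ⟩
        · by_contra! hno
          refine hxD (hD.le_of_ge ⟨Set.insert_subset hx hDT, hdisj.insert fun y hy _ => ?_⟩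
            (Set.subset_insert x D) (Set.mem_insert x D))
          exact Finset.disjoint_right.2 fun γ hγ => hno γ (Set.mem_iUnion₂.2 ⟨y, hy, hγ⟩)
      exact Set.mem_iUnion₂.2 ⟨γ, hγ, hx.1.1, hx.1.2, (Finset.mem_sdiff.1 hγx).1⟩
  · intro x hx A hA
    refine hF x A (Finset.disjoint_left.2 fun i hi hix => ?_)
    obtain ⟨y, hy, hne, hiy⟩ := hA i hi
    have hiΔ : i ∉ Δ := (Finset.mem_sdiff.1 hiy).2
    exact Finset.disjoint_left.1 (hdisj hy hx hne) hiy (Finset.mem_sdiff.2 ⟨hix, hiΔ⟩)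

/-- A linearly dense subset of `ℓ¹(Γ)` has an uncountable subset which is not linearly dense. -/
theorem exists_uncountable_not_dense_span {Γ : Type u} [Uncountable Γ] {S : Set ℓ¹(Γ, ℝ)}
    (hS : Dense (Submodule.span ℝ S : Set ℓ¹(Γ, ℝ))) :
    ∃ Λ ⊆ S, ¬ Λ.Countable ∧ ¬ Dense (Submodule.span ℝ Λ : Set ℓ¹(Γ, ℝ)) := by
  obtain ⟨η, hη, hS'⟩ := exists_not_isConcentrated hS
  obtain ⟨D, hDS, hD, G, M, hM, hdisj, hbig, hsmall⟩ := exists_pairwiseDisjoint_blocks hη hS'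
  obtain ⟨x₀, hx₀⟩ : D.Nonempty := by
    rw [Set.nonempty_iff_ne_empty]
    rintro rfl
    exact hD Set.countable_empty
  obtain ⟨γ, hγ⟩ : (G x₀).Nonempty := by
    rw [Finset.nonempty_iff_ne_empty]
    intro he
    have := hbig x₀ hx₀
    rw [he, Finset.sum_empty] at this
    linarith
  have hsub : D \ {x₀} ⊆ D := Set.sdiff_subset
  refine ⟨D \ {x₀}, hsub.trans hDS, fun h => hD (h.of_sdiff (Set.countable_singleton x₀)),
    not_dense_span_of_blocks G (p := η - η / 4) (q := η / 4) (M := M) (by linarith)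
      (fun x hx => hM x (hsub hx)) (hdisj.subset hsub) (fun x hx => hbig x (hsub hx))
      (fun x hx A hA => hsmall x (hsub hx) A fun i hi => ?_) (γ := γ) fun x hx hγx => ?_⟩
  · obtain ⟨y, hy, h⟩ := hA i hi
    exact ⟨y, hsub hy, h⟩
  · exact Finset.disjoint_left.1 (hdisj hx₀ (hsub hx) fun h => hx.2 h.symm) hγ hγx

/-! ### Densities above the first uncountable cardinal -/

theorem not_countable_iff_aleph_one_le {α : Type u} {A : Set α} :
    ¬ A.Countable ↔ ℵ₁ ≤ #A := by
  rw [← le_aleph0_iff_set_countable, not_le, aleph_one_le_iff]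

/-- A family of cardinals less than `κ` indexed by more than `ℵ₁` elements is bounded, on an
uncountable set of indices, by a single cardinal less than `κ`. Choose `ℵ₁` of the indices. Either
a single cardinal less than `κ` bounds the family on them, or the values there are cofinal in the
whole family; in the latter case the index set is covered by `ℵ₁` sets on which the family is
bounded by one of these values, and they cannot all be countable. -/
theorem exists_uncountable_setOf_le {Γ : Type u} (hΓ : ℵ₁ < #Γ) {κ : Cardinal.{u}}
    (f : Γ → Cardinal.{u}) (hf : ∀ γ, f γ < κ) :
    ∃ c < κ, ¬ {γ | f γ ≤ c}.Countable := by
  by_contra! h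
  obtain ⟨B, hB⟩ := le_mk_iff_exists_set.1 hΓ.le
  have hBc : ¬ B.Countable := not_countable_iff_aleph_one_le.2 hB.ge
  have hcov : (⋃ b ∈ B, {γ | f γ ≤ f b}) = Set.univ := by
    refine Set.eq_univ_of_forall fun γ => ?_
    by_contra hγ
    simp only [Set.mem_iUnion, Set.mem_ofPred_eq, not_exists, not_le] at hγ
    exact hBc ((h (f γ) (hf γ)).mono fun b hb => (hγ b hb).le)
  refine hΓ.not_ge ?_
  calc #Γ = #(⋃ b ∈ B, {γ | f γ ≤ f b} : Set Γ) := by rw [hcov, mk_univ]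
    _ ≤ #B * ⨆ b : B, #{γ | f γ ≤ f b} := mk_biUnion_le _ _
    _ ≤ ℵ₁ * ℵ₀ := by
        gcongr
        · exact hB.le
        · exact ciSup_le' fun b => (h _ (hf b)).le_aleph0
    _ = ℵ₁ := mul_aleph0_eq aleph0_lt_aleph_one.le

/-- If `ℵ₁ < |S|` and `|S| ≤ |Γ|`, then some coordinate vanishes at `|S|` elements of `S`. -/
theorem exists_mk_apply_eq_zero {Γ : Type u} {S : Set ℓ¹(Γ, ℝ)} (hS : ℵ₁ < #S)
    (hΓ : #S ≤ #Γ) : ∃ γ, #{x ∈ S | x γ = 0} = #S := by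
  by_contra! h
  obtain ⟨c, hc, hun⟩ := exists_uncountable_setOf_le (hS.trans_le hΓ)
    (fun γ => #{x ∈ S | x γ = 0})
    fun γ => lt_of_le_of_ne (mk_le_mk_of_subset fun x hx => hx.1) (h γ)
  rw [not_countable_iff_aleph_one_le, le_mk_iff_exists_subset] at hun
  obtain ⟨A, hA, hAcard⟩ := hun
  have hlt : #(⋃ γ ∈ A, {x ∈ S | x γ = 0} : Set ℓ¹(Γ, ℝ)) < #S := by
    calc #(⋃ γ ∈ A, {x ∈ S | x γ = 0} : Set ℓ¹(Γ, ℝ))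
        ≤ #A * ⨆ γ : A, #{x ∈ S | x γ = 0} := mk_biUnion_le _ _
      _ ≤ ℵ₁ * c := by
          gcongr
          · exact hAcard.le
          · exact ciSup_le' fun γ => hA γ.2
      _ < #S := mul_lt_of_lt (aleph0_lt_aleph_one.trans hS).le hS hc
  obtain ⟨x, hxS, hx⟩ : ∃ x ∈ S, x ∉ ⋃ γ ∈ A, {x ∈ S | x γ = 0} := by
    by_contra! hall
    exact hlt.not_ge (mk_le_mk_of_subset hall)
  exact not_countable_iff_aleph_one_le.2 hAcard.ge <|
    (countable_setOf_apply_ne_zero x).mono fun γ hγ hz => hx (Set.mem_iUnion₂.2 ⟨γ, hγ, hxS, hz⟩)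

/-! ### Overcomplete sets -/

theorem mainTheorem3 (Γ : Type u) [Uncountable Γ] :
    ¬ ∃ S : Set ℓ¹(Γ, ℝ), IsOvercomplete S := by
  rintro ⟨S, hcard, hS⟩
  rcases le_or_gt #S ℵ₁ with hle | hlt
  · obtain ⟨Λ, hΛS, hΛ, hnd⟩ := exists_uncountable_not_dense_span (hS S subset_rfl rfl)
    rw [not_countable_iff_aleph_one_le] at hΛ
    exact hnd (hS Λ hΛS ((mk_le_mk_of_subset hΛS).antisymm (hle.trans hΛ)))
  · obtain ⟨γ, hγ⟩ := exists_mk_apply_eq_zero hlt (hcard.trans_le (densityCharacter_lp_le Γ))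
    exact not_dense_span_of_apply_eq_zero (fun x hx => hx.2) (hS _ (fun x hx => hx.1) hγ)
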